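/- Let $(M,g)$ be a complete, non-compact smooth Riemannian manifold without boundary, let $q$ be a smooth $(0,2)$-tensor field on $M$, let $f:M\to\mathbb R$ be smooth, and let $\lambda\in\mathbb R$ with $\lambda\ge 0$. Suppose that $(M,g,f)$ is a gradient $q$-soliton, i.e. $$\operatorname{Hess} f=\lambda g+\tfrac12 q ,$$ and that it satisfies the Hamilton type identity $$Q(\nabla f)=\tfrac12\nabla\operatorname{tr}(q),$$ where $Q$ is the $(1,1)$-tensor dual to $q$, $g(Q(X),Y)=q(X,Y)$, and $\operatorname{tr}$ is the trace with respect to $g$. Assume that $$\liminf_{x\to\infty}\Bigl(-\tfrac12\operatorname{tr}(q)(x)\Bigr)\ge 0$$ (where $x\to\infty$ means that $x$ leaves every compact subset of $M$, and the value $+\infty$ is allowed) and that $(\operatorname{div} q)(\nabla f)\ge 0$ on $M$, where $(\operatorname{div}q)(Z)=\sum_i(\nabla_{e_i}q)(e_i,Z)$ for orthonormal frames $(e_i)$. Then $\operatorname{tr}(q)\le 0$ everywhere on $M$. -/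

import Mathlib

open Bundle Filter VectorField
open scoped Manifold ContDiff Topology

set_option linter.unusedSectionVars false

noncomputable section

namespace QSoliton

/-! ### Riemannian manifolds: gradient and Levi-Civita connection

`M` is a manifold modelled on a finite-dimensional space, and `inner ℝ` on `TangentSpace I x` is its
Riemannian metric `g`. -/

section Basic

variable {E : Type*} [NormedAddCommGroup E] [NormedSpace ℝ E] [FiniteDimensional ℝ E]
  {H : Type*} [TopologicalSpace H] (I : ModelWithCorners ℝ E H)
  {M : Type*} [TopologicalSpace M] [ChartedSpace H M]

instance finiteDimensional_tangentSpace (x : M) : FiniteDimensional ℝ (TangentSpace I x) :=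
  inferInstanceAs (FiniteDimensional ℝ E)

variable [RiemannianBundle (fun x : M => TangentSpace I x)]

instance completeSpace_tangentSpace (x : M) : CompleteSpace (TangentSpace I x) :=
  FiniteDimensional.complete ℝ (TangentSpace I x)

/-- The tangent vector `φ♯` dual to a covector `φ`, that is `g(φ♯, v) = φ(v)` for all `v`. -/
def sharp {x : M} (φ : TangentSpace I x →L[ℝ] ℝ) : TangentSpace I x :=
  (InnerProductSpace.toDual ℝ (TangentSpace I x)).symm φ

theorem inner_sharp {x : M} (φ : TangentSpace I x →L[ℝ] ℝ) (v : TangentSpace I x) :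
    inner ℝ (sharp I φ) v = φ v := by
  simp [sharp]

/-- The gradient `∇u`, the vector field with `g(∇u, v) = du(v)`. -/
def grad (u : M → ℝ) (x : M) : TangentSpace I x :=
  sharp I (mvfderiv I u x)

/-- The right-hand side of the Koszul formula for `2 g(∇_X Y, Z)`. -/
def koszul (X Y Z : Π x : M, TangentSpace I x) (x : M) : ℝ :=
  mvfderiv I (fun y => inner ℝ (Y y) (Z y)) x (X x)
    + mvfderiv I (fun y => inner ℝ (X y) (Z y)) x (Y x)
    - mvfderiv I (fun y => inner ℝ (X y) (Y y)) x (Z x)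
    + inner ℝ (mlieBracket I X Y x) (Z x)
    - inner ℝ (mlieBracket I X Z x) (Y x)
    - inner ℝ (mlieBracket I Y Z x) (X x)

variable [IsManifold I ∞ M] [IsContMDiffRiemannianBundle I ∞ E (fun x : M => TangentSpace I x)]

theorem mdifferentiableAt_inner {X Z : Π x : M, TangentSpace I x} {x : M}
    (hX : MDiffAt (T% X) x) (hZ : MDiffAt (T% Z) x) :
    MDiffAt (fun y => (inner ℝ (X y) (Z y) : ℝ)) x :=
  MDifferentiableAt.inner_bundle (F := E) (E := fun x : M => TangentSpace I x) (IB := I)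
    (b := fun y => y) hX hZ

theorem mvfderiv_inner_smul_left {X Z : Π x : M, TangentSpace I x} {f : M → ℝ} {x : M}
    (hf : MDiffAt f x) (hX : MDiffAt (T% X) x) (hZ : MDiffAt (T% Z) x) (v : TangentSpace I x) :
    mvfderiv I (fun y => (inner ℝ ((f • X) y) (Z y) : ℝ)) x v =
      f x * mvfderiv I (fun y => (inner ℝ (X y) (Z y) : ℝ)) x v
        + inner ℝ (X x) (Z x) * mvfderiv I f x v := by
  have h := mvfderiv_fun_mul hf (mdifferentiableAt_inner I hX hZ)
  have e : (fun y => (inner ℝ ((f • X) y) (Z y) : ℝ)) = fun y => f y * inner ℝ (X y) (Z y) := by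
    funext y
    exact real_inner_smul_left _ _ _
  rw [e, h]
  rfl

theorem mvfderiv_inner_add_left {X X' Z : Π x : M, TangentSpace I x} {x : M}
    (hX : MDiffAt (T% X) x) (hX' : MDiffAt (T% X') x) (hZ : MDiffAt (T% Z) x)
    (v : TangentSpace I x) :
    mvfderiv I (fun y => (inner ℝ ((X + X') y) (Z y) : ℝ)) x v =
      mvfderiv I (fun y => (inner ℝ (X y) (Z y) : ℝ)) x v
        + mvfderiv I (fun y => (inner ℝ (X' y) (Z y) : ℝ)) x v := by
  have h := mvfderiv_fun_add (mdifferentiableAt_inner I hX hZ) (mdifferentiableAt_inner I hX' hZ)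
  have e : (fun y => (inner ℝ ((X + X') y) (Z y) : ℝ)) =
      fun y => inner ℝ (X y) (Z y) + inner ℝ (X' y) (Z y) := by
    funext y
    exact inner_add_left _ _ _
  rw [e, h]
  rfl

theorem mvfderiv_inner_comm (X Z : Π x : M, TangentSpace I x) :
    mvfderiv I (fun y => (inner ℝ (X y) (Z y) : ℝ)) =
      mvfderiv I (fun y => (inner ℝ (Z y) (X y) : ℝ)) := by
  congr 1
  funext y
  exact real_inner_comm _ _

theorem tensorialAt_koszul_left {Y Z : Π x : M, TangentSpace I x} {x : M}
    (hY : MDiffAt (T% Y) x) (hZ : MDiffAt (T% Z) x) :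
    TensorialAt I E (fun X => koszul I X Y Z x) x where
  smul := by
    intro f X hf hX
    have := FiniteDimensional.complete ℝ E
    simp only [koszul]
    rw [mvfderiv_inner_smul_left I hf hX hZ, mvfderiv_inner_smul_left I hf hX hY,
      mlieBracket_smul_left hf hX, mlieBracket_smul_left hf hX]
    simp only [Pi.smul_apply', map_smul, smul_eq_mul, inner_add_left,
      real_inner_smul_left, real_inner_smul_right]
    ring
  add := by
    intro X X' hX hX'
    have := FiniteDimensional.complete ℝ E
    simp only [koszul]
    rw [mvfderiv_inner_add_left I hX hX' hZ, mvfderiv_inner_add_left I hX hX' hY,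
      mlieBracket_add_left hX hX', mlieBracket_add_left hX hX']
    simp only [Pi.add_apply, map_add, inner_add_left, inner_add_right]
    ring

theorem koszul_sub_swap (X Y Z : Π x : M, TangentSpace I x) (x : M) :
    koszul I X Y Z x = koszul I Y X Z x + 2 * inner ℝ (mlieBracket I X Y x) (Z x) := by
  simp only [koszul]
  rw [mvfderiv_inner_comm I Y X, mlieBracket_swap_apply (V := Y) (W := X)]
  simp only [inner_neg_left]
  ring

theorem koszul_add_swap (X Y Z : Π x : M, TangentSpace I x) (x : M) :
    koszul I X Y Z x + koszul I X Z Y x =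
      2 * mvfderiv I (fun y => (inner ℝ (Y y) (Z y) : ℝ)) x (X x) := by
  simp only [koszul]
  rw [mvfderiv_inner_comm I Z Y, mlieBracket_swap_apply (V := Z) (W := Y)]
  simp only [inner_neg_left]
  ring

theorem koszul_smul_mid {X Y Z : Π x : M, TangentSpace I x} {f : M → ℝ} {x : M}
    (hf : MDiffAt f x) (hX : MDiffAt (T% X) x) (hY : MDiffAt (T% Y) x) (hZ : MDiffAt (T% Z) x) :
    koszul I X (f • Y) Z x =
      f x * koszul I X Y Z x + 2 * (mvfderiv I f x (X x) * inner ℝ (Y x) (Z x)) := by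
  have := FiniteDimensional.complete ℝ E
  have h := (tensorialAt_koszul_left I hX hZ).smul hf hY
  simp only [smul_eq_mul] at h
  rw [koszul_sub_swap, h, koszul_sub_swap I X Y, mlieBracket_smul_right hf hY]
  simp only [inner_add_left, real_inner_smul_left]
  ring

theorem koszul_add_mid {X Y Y' Z : Π x : M, TangentSpace I x} {x : M}
    (hX : MDiffAt (T% X) x) (hY : MDiffAt (T% Y) x) (hY' : MDiffAt (T% Y') x)
    (hZ : MDiffAt (T% Z) x) :
    koszul I X (Y + Y') Z x = koszul I X Y Z x + koszul I X Y' Z x := by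
  have := FiniteDimensional.complete ℝ E
  have h := (tensorialAt_koszul_left I hX hZ).add hY hY'
  rw [koszul_sub_swap, h, koszul_sub_swap I X Y, koszul_sub_swap I X Y',
    mlieBracket_add_right hY hY']
  simp only [inner_add_left]
  ring

theorem tensorialAt_koszul_right {X Y : Π x : M, TangentSpace I x} {x : M}
    (hX : MDiffAt (T% X) x) (hY : MDiffAt (T% Y) x) :
    TensorialAt I E (fun Z => koszul I X Y Z x) x where
  smul := by
    intro f Z hf hZ
    have h := koszul_add_swap I X Y (f • Z) x
    have h' := koszul_add_swap I X Y Z x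
    rw [mvfderiv_inner_comm I Y, mvfderiv_inner_smul_left I hf hZ hY,
      koszul_smul_mid I hf hX hZ hY, mvfderiv_inner_comm I Z] at h
    simp only [smul_eq_mul]
    linear_combination h - f x * h'
  add := by
    intro Z Z' hZ hZ'
    have h := koszul_add_swap I X Y (Z + Z') x
    have h1 := koszul_add_swap I X Y Z x
    have h2 := koszul_add_swap I X Y Z' x
    rw [mvfderiv_inner_comm I Y, mvfderiv_inner_add_left I hZ hZ' hY,
      koszul_add_mid I hX hZ hZ' hY, mvfderiv_inner_comm I Z, mvfderiv_inner_comm I Z'] at h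
    linear_combination h - h1 - h2

/-- The bilinear form `(v, w) ↦ g(∇_v Y, w)` at `x` given by the Koszul formula. -/
def koszulForm {Y : Π x : M, TangentSpace I x} {x : M} (hY : MDiffAt (T% Y) x) :
    TangentSpace I x →L[ℝ] TangentSpace I x →L[ℝ] ℝ :=
  (1 / 2 : ℝ) • TensorialAt.mkHom₂ (fun X Z => koszul I X Y Z x) x
    (fun _ hZ => tensorialAt_koszul_left I hY hZ) (fun _ hX => tensorialAt_koszul_right I hX hY)

theorem koszulForm_apply {X Y Z : Π x : M, TangentSpace I x} {x : M}
    (hX : MDiffAt (T% X) x) (hY : MDiffAt (T% Y) x) (hZ : MDiffAt (T% Z) x) :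
    koszulForm I hY (X x) (Z x) = 1 / 2 * koszul I X Y Z x := by
  have h := TensorialAt.mkHom₂_apply (Φ := fun X Z => koszul I X Y Z x)
    (fun _ hZ => tensorialAt_koszul_left I hY hZ) (fun _ hX => tensorialAt_koszul_right I hX hY)
    hX hZ
  rw [← h]
  rfl

open Classical in
/-- `∇_v Y` as a function of `v`: it is characterised by `2 g(∇_X Y, Z) = koszul X Y Z`. If the
field `Y` is not differentiable at `x`, then the value is `0` by convention. -/
def leviCivitaFun (Y : Π x : M, TangentSpace I x) (x : M) :
    TangentSpace I x →L[ℝ] TangentSpace I x :=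
  if hY : MDiffAt (T% Y) x then
    LinearMap.toContinuousLinearMap
      { toFun := fun v => sharp I (koszulForm I hY v)
        map_add' := fun v w => by simp [sharp]
        map_smul' := fun c v => by simp [sharp] }
  else 0

theorem inner_leviCivitaFun {X Y Z : Π x : M, TangentSpace I x} {x : M}
    (hX : MDiffAt (T% X) x) (hY : MDiffAt (T% Y) x) (hZ : MDiffAt (T% Z) x) :
    inner ℝ (leviCivitaFun I Y x (X x)) (Z x) = 1 / 2 * koszul I X Y Z x := by
  rw [← koszulForm_apply I hX hY hZ, ← inner_sharp, leviCivitaFun, dif_pos hY]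
  rfl

theorem leviCivitaFun_ext {x : M} {A B : TangentSpace I x →L[ℝ] TangentSpace I x}
    (h : ∀ X Z : Π x : M, TangentSpace I x, MDiffAt (T% X) x → MDiffAt (T% Z) x →
      inner ℝ (A (X x)) (Z x) = (inner ℝ (B (X x)) (Z x) : ℝ)) : A = B := by
  ext v
  refine ext_inner_right ℝ fun w => ?_
  have := h (FiberBundle.extend E v) (FiberBundle.extend E w)
    (FiberBundle.mdifferentiableAt_extend ..) (FiberBundle.mdifferentiableAt_extend ..)
  simpa using this

/-- The Levi-Civita connection of the Riemannian metric; `leviCivita I Y x v` is `∇_v Y`. -/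
def leviCivita : CovariantDerivative I E (fun x : M => TangentSpace I x) where
  toFun := leviCivitaFun I
  isCovariantDerivativeOnUniv :=
    { add := by
        intro Y Y' x hY hY' _
        refine leviCivitaFun_ext I fun X Z hX hZ => ?_
        rw [inner_leviCivitaFun I hX (mdifferentiableAt_add_section hY hY') hZ, koszul_add_mid I hX hY hY' hZ,
          _root_.add_apply, inner_add_left, inner_leviCivitaFun I hX hY hZ,
          inner_leviCivitaFun I hX hY' hZ]
        ring
      leibniz := by
        intro Y f x hY hf _
        refine leviCivitaFun_ext I fun X Z hX hZ => ?_
        rw [inner_leviCivitaFun I hX (hf.smul_section hY) hZ, koszul_smul_mid I hf hX hY hZ,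
          _root_.add_apply, inner_add_left, _root_.smul_apply,
          real_inner_smul_left, inner_leviCivitaFun I hX hY hZ,
          ContinuousLinearMap.smulRight_apply, real_inner_smul_left]
        ring }

/-- The Levi-Civita connection is compatible with the metric. -/
theorem leviCivita_metric {X Y Z : Π x : M, TangentSpace I x} {x : M}
    (hX : MDiffAt (T% X) x) (hY : MDiffAt (T% Y) x) (hZ : MDiffAt (T% Z) x) :
    mvfderiv I (fun y => (inner ℝ (Y y) (Z y) : ℝ)) x (X x) =
      inner ℝ (leviCivita I Y x (X x)) (Z x) + inner ℝ (Y x) (leviCivita I Z x (X x)) := by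
  have h1 : inner ℝ (leviCivita I Y x (X x)) (Z x) = 1 / 2 * koszul I X Y Z x :=
    inner_leviCivitaFun I hX hY hZ
  have h2 : inner ℝ (leviCivita I Z x (X x)) (Y x) = 1 / 2 * koszul I X Z Y x :=
    inner_leviCivitaFun I hX hZ hY
  have h := koszul_add_swap I X Y Z x
  rw [real_inner_comm] at h2
  linear_combination -h1 - h2 - h / 2

/-- The Levi-Civita connection is torsion-free. -/
theorem leviCivita_torsion [CompleteSpace E] [IsManifold I 2 M] :
    (leviCivita I (M := M)).torsion = 0 := by
  rw [CovariantDerivative.torsion_eq_zero_iff]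
  intro X Y x hX hY
  refine ext_inner_right ℝ fun w => ?_
  have hZ : MDiffAt (T% (FiberBundle.extend E w)) x := FiberBundle.mdifferentiableAt_extend ..
  have h1 := inner_leviCivitaFun I hX hY hZ
  have h2 := inner_leviCivitaFun I hY hX hZ
  have h := koszul_sub_swap I X Y (FiberBundle.extend E w) x
  rw [FiberBundle.extend_apply_self] at h1 h2 h
  rw [inner_sub_left]
  change inner ℝ (leviCivitaFun I Y x (X x)) w - inner ℝ (leviCivitaFun I X x (Y x)) w = _
  linear_combination h1 - h2 + h / 2

/-- The Hessian of `f`: `Hess f (v, w) = g(∇_v ∇f, w)`. -/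
def hess (f : M → ℝ) (x : M) (v w : TangentSpace I x) : ℝ :=
  inner ℝ (leviCivita I (grad I f) x v) w

end Basic

/-! ### Tensors of type `(0, 2)` -/

section Tensor

variable {E : Type*} [NormedAddCommGroup E] [NormedSpace ℝ E] [FiniteDimensional ℝ E]
  {H : Type*} [TopologicalSpace H] (I : ModelWithCorners ℝ E H)
  {M : Type*} [TopologicalSpace M] [ChartedSpace H M]
  [IsManifold I ∞ M]
  [RiemannianBundle (fun x : M => TangentSpace I x)]
  [IsContMDiffRiemannianBundle I ∞ E (fun x : M => TangentSpace I x)]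
  (q : Π x : M, TangentSpace I x →L[ℝ] TangentSpace I x →L[ℝ] ℝ)

/-- The tensor field `q` is smooth, as a section of the bundle of bilinear forms on `TM`. -/
def IsSmoothTensor : Prop :=
  ContMDiff I (I.prod 𝓘(ℝ, E →L[ℝ] E →L[ℝ] ℝ)) ∞
    (fun x => TotalSpace.mk' (E →L[ℝ] E →L[ℝ] ℝ)
      (E := fun x : M => TangentSpace I x →L[ℝ] TangentSpace I x →L[ℝ] ℝ) x (q x))

/-- The `(1,1)`-tensor `Q` dual to `q`: `g(Q(v), w) = q(v, w)`. -/
def dualEndo (x : M) (v : TangentSpace I x) : TangentSpace I x :=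
  sharp I (q x v)

/-- The trace of `q` with respect to `g`, computed in an orthonormal basis of the tangent space. -/
def tr (x : M) : ℝ :=
  ∑ i, q x (stdOrthonormalBasis ℝ (TangentSpace I x) i) (stdOrthonormalBasis ℝ (TangentSpace I x) i)

/-- `u(q(V, W)) - q(∇_u V, W) - q(V, ∇_u W)` for vector fields `V`, `W`. -/
def covDerivAux (V W : Π x : M, TangentSpace I x) (x : M) (u : TangentSpace I x) : ℝ :=
  mvfderiv I (fun y => q y (V y) (W y)) x u
    - q x (leviCivita I V x u) (W x) - q x (V x) (leviCivita I W x u)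

/-- The covariant derivative `(∇_u q)(v, w)`. Here `v` and `w` are extended to vector fields that are
differentiable at `x`; the result does not depend on the extension, see `covDeriv_eq`. -/
def covDeriv (x : M) (u v w : TangentSpace I x) : ℝ :=
  covDerivAux I q (FiberBundle.extend E v) (FiberBundle.extend E w) x u

variable {q} in
theorem covDeriv_eq (hq : IsSmoothTensor I q) {V W : Π x : M, TangentSpace I x} {x : M}
    (hV : MDiffAt (T% V) x) (hW : MDiffAt (T% W) x) (u : TangentSpace I x) :
    covDeriv I q x u (V x) (W x) = covDerivAux I q V W x u := by
  have D {V W : Π x : M, TangentSpace I x} (hV : MDiffAt (T% V) x) (hW : MDiffAt (T% W) x) :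
      MDiffAt (fun y => q y (V y) (W y)) x := by
    have hq' := (hq x).mdifferentiableAt (by simp)
    have : MDifferentiableAt I (I.prod 𝓘(ℝ))
        (fun m => TotalSpace.mk' ℝ (E := Bundle.Trivial M ℝ) m (q m (V m) (W m))) x :=
      MDifferentiableAt.clm_bundle_apply₂ (F₁ := E) (F₂ := E) hq' hV hW
    simp only [mdifferentiableAt_totalSpace] at this
    exact this.2
  refine TensorialAt.pointwise₂ (Φ := fun V W => covDerivAux I q V W x u) (I := I) (F := E)
    (F' := E) ?_ ?_ (FiberBundle.mdifferentiableAt_extend ..) hV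
    (FiberBundle.mdifferentiableAt_extend ..) hW (by simp) (by simp)
  · intro W hW
    constructor
    · intro f V hf hV
      have e : (fun y => q y ((f • V) y) (W y)) = fun y => f y * q y (V y) (W y) := by
        funext y
        simp
      simp only [covDerivAux]
      rw [(leviCivita I).isCovariantDerivativeOnUniv.leibniz hV hf, e, mvfderiv_fun_mul hf (D hV hW)]
      simp
      ring
    · intro V V' hV hV'
      have e : (fun y => q y ((V + V') y) (W y)) = fun y => q y (V y) (W y) + q y (V' y) (W y) := by
        funext y
        simp
      simp only [covDerivAux]
      rw [(leviCivita I).isCovariantDerivativeOnUniv.add hV hV', e,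
        mvfderiv_fun_add (D hV hW) (D hV' hW)]
      simp
      ring
  · intro V hV
    constructor
    · intro f W hf hW
      have e : (fun y => q y (V y) ((f • W) y)) = fun y => f y * q y (V y) (W y) := by
        funext y
        simp
      simp only [covDerivAux]
      rw [(leviCivita I).isCovariantDerivativeOnUniv.leibniz hW hf, e, mvfderiv_fun_mul hf (D hV hW)]
      simp
      ring
    · intro W W' hW hW'
      have e : (fun y => q y (V y) ((W + W') y)) = fun y => q y (V y) (W y) + q y (V y) (W' y) := by
        funext y
        simp
      simp only [covDerivAux]
      rw [(leviCivita I).isCovariantDerivativeOnUniv.add hW hW', e,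
        mvfderiv_fun_add (D hV hW) (D hV hW')]
      simp
      ring

/-- The divergence of `q`, the 1-form `(div q)(w) = ∑ i, (∇_{e i} q)(e i, w)` for an orthonormal
basis `e` of the tangent space. -/
def div (x : M) (w : TangentSpace I x) : ℝ :=
  ∑ i, covDeriv I q x (stdOrthonormalBasis ℝ (TangentSpace I x) i)
    (stdOrthonormalBasis ℝ (TangentSpace I x) i) w

/-- `(M, g, f)` is a gradient `q`-soliton with constant `lam`: `q` is a smooth `(0,2)`-tensor, `f` is
a smooth function, and `Hess f = lam g + (1/2) q`. -/
structure IsGradientSoliton (f : M → ℝ) (lam : ℝ) : Prop where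
  smooth_tensor : IsSmoothTensor I q
  smooth_potential : ContMDiff I 𝓘(ℝ, ℝ) ∞ f
  hess_eq : ∀ (x : M) (v w : TangentSpace I x),
    hess I f x v w = lam * inner ℝ v w + 1 / 2 * q x v w

/-- `f` and `q` satisfy a Hamilton type identity: `Q(∇f) = (1/2) ∇ tr(q)`. -/
def HamiltonIdentity (f : M → ℝ) : Prop :=
  ∀ x : M, dualEndo I q x (grad I f x) = (1 / 2 : ℝ) • grad I (tr I q) x

end Tensor

end QSoliton

end

/-!
The proof is a maximum principle for `u = tr q`.

Suppose `u` is positive somewhere. The assumption on the limit inferior says that `u` is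
asymptotically nonpositive at infinity, so `u` attains its maximum at some point `x`
(`exists_isMax_of_liminf`), and it is enough to show `u x ≤ 0` (`tr_nonpos_of_isLocalMax`).

The tensor `q` is symmetric, because `Hess f` and `g` are (`hess_comm`). Taking the divergence of
the Hamilton identity `du = 2 q(∇f, ·)` and inserting the soliton equation gives
`½ Δu = (div q)(∇f) + λ u + ½ |q|²`. At the maximum `Δu ≤ 0`, while all three summands on the right
are nonnegative if `u x > 0`; so `|q|² = 0` at `x`, and then `u x = tr q = 0`.

The Laplacian is only needed at the critical point `x`. There it is the sum of the second
derivatives of `u` along the coordinate vector fields `FiberBundle.extend E (e i)` of the chart at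
`x` that extend an orthonormal basis `e` of the tangent space: the terms with Christoffel symbols
contain `du x = 0`. In the chart such a second derivative is an ordinary one
(`mvfderiv_mvfderiv_extend`), which gives both the second derivative test at a local maximum and the
symmetry of the Hessian. The differentiability of `tr q` and of gradients is obtained from a smooth
local frame and the inverse of its Gram matrix (`contMDiff_tr`, `contMDiff_grad`).
-/

namespace QSoliton

/-! ### Second derivatives in normed spaces -/

theorem deriv_deriv_nonpos_of_isLocalMax {h : ℝ → ℝ} {a : ℝ} (hmax : IsLocalMax h a)
    (hc : ContinuousAt h a) : deriv (deriv h) a ≤ 0 := by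
  by_contra! hpos
  -- a local maximum that is also a local minimum: `h` is constant near `a`
  have hmin := isLocalMin_of_deriv_deriv_pos hpos hmax.deriv_eq_zero hc
  have hconst : h =ᶠ[𝓝 a] fun _ => h a := by
    filter_upwards [hmax, hmin] with t h1 h2 using le_antisymm h1 h2
  have := hconst.deriv.deriv_eq
  simp at this
  linarith

section Calculus

variable {E : Type*} [NormedAddCommGroup E] [NormedSpace ℝ E]

theorem lieBracket_eq_zero_of_eventuallyEq_const {V W : E → E} {z v w : E}
    (hV : V =ᶠ[𝓝 z] fun _ => v) (hW : W =ᶠ[𝓝 z] fun _ => w) : lieBracket ℝ V W z = 0 := by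
  rw [hV.lieBracket_vectorField_eq hW]
  simp [lieBracket]

theorem fderiv_fderiv_apply_comm {U : E → ℝ} {z : E} (hU : ContDiffAt ℝ 2 U z) (v w : E) :
    fderiv ℝ (fun y => fderiv ℝ U y w) z v = fderiv ℝ (fun y => fderiv ℝ U y v) z w := by
  have hs := hU.isSymmSndFDerivAt (by simp)
  have hd := (hU.fderiv_right (m := 1) (by norm_num)).differentiableAt (by norm_num)
  rw [fderiv_clm_apply hd (differentiableAt_const _),
    fderiv_clm_apply hd (differentiableAt_const _)]
  simpa using hs.eq v w

theorem fderiv_fderiv_nonpos_of_isLocalMax {U : E → ℝ} {z v : E} (hmax : IsLocalMax U z)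
    (hU : ∀ᶠ y in 𝓝 z, DifferentiableAt ℝ U y)
    (hd : DifferentiableAt ℝ (fun y => fderiv ℝ U y v) z) :
    fderiv ℝ (fun y => fderiv ℝ U y v) z v ≤ 0 := by
  have hl (t : ℝ) : HasDerivAt (fun t : ℝ => z + t • v) v t := by
    simpa using ((hasDerivAt_id t).smul_const v).const_add z
  have hz : z + (0 : ℝ) • v = z := by simp
  have hl0 : Tendsto (fun t : ℝ => z + t • v) (𝓝 0) (𝓝 z) := by
    simpa using (hl 0).continuousAt.tendsto
  have h1 : deriv (fun t : ℝ => U (z + t • v)) =ᶠ[𝓝 0] fun t => fderiv ℝ U (z + t • v) v := by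
    filter_upwards [hl0.eventually hU] with t ht
    exact (ht.hasFDerivAt.comp_hasDerivAt t (hl t)).deriv
  have h2 : deriv (deriv fun t : ℝ => U (z + t • v)) 0 =
      fderiv ℝ (fun y => fderiv ℝ U y v) z v := by
    rw [h1.deriv_eq]
    rw [← hz] at hd
    have := (hd.hasFDerivAt.comp_hasDerivAt (0 : ℝ) (hl 0)).deriv
    simpa only [Function.comp_def, hz] using this
  rw [← h2]
  refine deriv_deriv_nonpos_of_isLocalMax ?_ ?_
  · filter_upwards [hl0.eventually hmax] with t ht
    simpa using ht
  · have hU0 := hU.self_of_nhds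
    rw [← hz] at hU0
    exact (hU0.hasFDerivAt.comp_hasDerivAt (0 : ℝ) (hl 0)).continuousAt

end Calculus

/-! ### Coordinate vector fields of a chart -/

section Coordinates

variable {E : Type*} [NormedAddCommGroup E] [NormedSpace ℝ E]
  {H : Type*} [TopologicalSpace H] (I : ModelWithCorners ℝ E H)
  {M : Type*} [TopologicalSpace M] [ChartedSpace H M] [IsManifold I ∞ M]

/-- Near `x`, the extension of a tangent vector at `x` is the coordinate vector field of the chart at
`x` with constant coefficients. -/
theorem extend_eq_mfderivWithin_symm {x y : M} (hy : y ∈ (chartAt H x).source)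
    (v : TangentSpace I x) :
    FiberBundle.extend E v y =
      mfderivWithin 𝓘(ℝ, E) I (extChartAt I x).symm (Set.range I) (extChartAt I x y) v := by
  have hv : (trivializationAt E (TangentSpace I) x ⟨x, v⟩).2 = v := by
    have h := TangentBundle.continuousLinearMapAt_trivializationAt (𝕜 := ℝ) (I := I)
      (mem_chart_source H x)
    rw [mfderiv_extChartAt_self] at h
    have h' := DFunLike.congr_fun h v
    rw [Trivialization.continuousLinearMapAt_apply,
      Trivialization.coe_linearMapAt_of_mem _ (FiberBundle.mem_baseSet_trivializationAt' x)] at h'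
    exact h'
  have h1 : FiberBundle.extend E v y =
      (trivializationAt E (TangentSpace I) x).symmL ℝ y v := by
    have h2 := Trivialization.symmL_apply (R := ℝ) (trivializationAt E (TangentSpace I) x) (b := y)
      (by simpa using hy) v
    refine Eq.trans ?_ h2.symm
    change (trivializationAt E (TangentSpace I) x).symm y
      (trivializationAt E (TangentSpace I) x ⟨x, v⟩).2 = _
    exact congrArg _ hv
  exact h1.trans (DFunLike.congr_fun
    (TangentBundle.symmL_trivializationAt (𝕜 := ℝ) (E := E) (I := I) hy) v)

/-- Derivatives along coordinate vector fields are derivatives in the chart. -/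
theorem mvfderiv_extend [I.Boundaryless] {u : M → ℝ} {x y : M} (hy : y ∈ (chartAt H x).source)
    (hu : MDifferentiableAt I 𝓘(ℝ) u y) (v : TangentSpace I x) :
    mvfderiv I u y (FiberBundle.extend E v y) =
      fderiv ℝ (u ∘ (extChartAt I x).symm) (extChartAt I x y) v := by
  have hy' : y ∈ (extChartAt I x).source := by rwa [extChartAt_source]
  have hz : (extChartAt I x).symm (extChartAt I x y) = y := (extChartAt I x).left_inv hy'
  have hd := mdifferentiableWithinAt_extChartAt_symm (I := I)
    ((extChartAt I x).map_source hy')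
  rw [I.range_eq_univ, mdifferentiableWithinAt_univ] at hd
  rw [extend_eq_mfderivWithin_symm I hy, I.range_eq_univ, mfderivWithin_univ]
  have h := mfderiv_comp_apply_of_eq (x := extChartAt I x y) (f := (extChartAt I x).symm) (g := u)
    (I := 𝓘(ℝ, E)) (I' := I) (I'' := 𝓘(ℝ)) hu hd hz v
  rw [mfderiv_eq_fderiv] at h
  exact h.symm

theorem mlieBracket_extend [I.Boundaryless] (x : M) (v w : TangentSpace I x) :
    mlieBracket I (FiberBundle.extend E v) (FiberBundle.extend E w) x = 0 := by
  have key (v : TangentSpace I x) : ∀ z ∈ (extChartAt I x).target,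
      mpullbackWithin 𝓘(ℝ, E) I (extChartAt I x).symm (FiberBundle.extend E v) (Set.range I) z
        = v := by
    intro z hz
    have hs : (extChartAt I x).symm z ∈ (chartAt H x).source := by
      rw [← extChartAt_source I]; exact (extChartAt I x).map_target hz
    rw [mpullbackWithin_apply, extend_eq_mfderivWithin_symm I hs, (extChartAt I x).right_inv hz]
    obtain ⟨e, he⟩ := isInvertible_mfderivWithin_extChartAt_symm hz
    rw [← he, ContinuousLinearMap.inverse_equiv]
    exact e.symm_apply_apply v
  have hev (v : TangentSpace I x) :
      mpullbackWithin 𝓘(ℝ, E) I (extChartAt I x).symm (FiberBundle.extend E v) (Set.range I)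
        =ᶠ[𝓝 (extChartAt I x x)] fun _ => v :=
    Filter.eventually_of_mem (extChartAt_target_mem_nhds x) (key v)
  have h0 : lieBracketWithin ℝ
      (mpullbackWithin 𝓘(ℝ, E) I (extChartAt I x).symm (FiberBundle.extend E v) (Set.range I))
      (mpullbackWithin 𝓘(ℝ, E) I (extChartAt I x).symm (FiberBundle.extend E w) (Set.range I))
      ((extChartAt I x).symm ⁻¹' Set.univ ∩ Set.range I) (extChartAt I x x) = 0 := by
    rw [I.range_eq_univ] at hev ⊢
    have hr : (extChartAt I x).symm ⁻¹' Set.univ ∩ Set.univ = Set.univ := by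
      rw [Set.preimage_univ, Set.univ_inter]
    refine (congrArg (fun s => lieBracketWithin ℝ _ _ s _) hr).trans ?_
    exact (congrFun lieBracketWithin_univ _).trans
      (lieBracket_eq_zero_of_eventuallyEq_const (hev v) (hev w))
  rw [← mlieBracketWithin_univ, mlieBracketWithin_apply]
  exact (congrArg _ h0).trans (map_zero _)

/-- In the chart at `x`, coordinate derivatives of coordinate derivatives are second derivatives. -/
theorem mvfderiv_mvfderiv_extend [I.Boundaryless] {u : M → ℝ} {x : M}
    (hu : ∀ᶠ y in 𝓝 x, MDifferentiableAt I 𝓘(ℝ) u y) (v w : TangentSpace I x)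
    (hd : MDifferentiableAt I 𝓘(ℝ)
      (fun y => mvfderiv I u y (FiberBundle.extend E w y)) x) :
    DifferentiableAt ℝ (fun z => fderiv ℝ (u ∘ (extChartAt I x).symm) z w) (extChartAt I x x) ∧
    mvfderiv I (fun y => mvfderiv I u y (FiberBundle.extend E w y)) x v =
      fderiv ℝ (fun z => fderiv ℝ (u ∘ (extChartAt I x).symm) z w) (extChartAt I x x) v := by
  have h := mvfderiv_extend I (mem_chart_source H x) hd v
  rw [FiberBundle.extend_apply_self] at h
  have hc : ContinuousAt (extChartAt I x).symm (extChartAt I x x) :=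
    continuousAt_extChartAt_symm x
  have ht : ∀ᶠ z in 𝓝 (extChartAt I x x), z ∈ (extChartAt I x).target :=
    extChartAt_target_mem_nhds x
  have hu' := hc.eventually (by rwa [extChartAt_to_inv])
  have he : (fun y => mvfderiv I u y (FiberBundle.extend E w y)) ∘ (extChartAt I x).symm
      =ᶠ[𝓝 (extChartAt I x x)] fun z => fderiv ℝ (u ∘ (extChartAt I x).symm) z w := by
    filter_upwards [ht, hu'] with z hz huz
    have hs : (extChartAt I x).symm z ∈ (chartAt H x).source := by
      rw [← extChartAt_source I]; exact (extChartAt I x).map_target hz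
    rw [Function.comp_apply, mvfderiv_extend I hs huz, (extChartAt I x).right_inv hz]
  have hd' := MDifferentiableWithinAt.differentiableWithinAt_comp_extChartAt_symm
    (mdifferentiableWithinAt_univ.2 hd)
  rw [Set.preimage_univ, Set.univ_inter] at hd'
  rw [I.range_eq_univ, differentiableWithinAt_univ] at hd'
  exact ⟨hd'.congr_of_eventuallyEq he.symm, by rw [h, he.fderiv_eq]⟩

theorem mvfderiv_mvfderiv_extend_comm [I.Boundaryless] {u : M → ℝ} {x : M}
    (hu : ContMDiff I 𝓘(ℝ) ∞ u) (v w : TangentSpace I x)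
    (hv : MDifferentiableAt I 𝓘(ℝ) (fun y => mvfderiv I u y (FiberBundle.extend E v y)) x)
    (hw : MDifferentiableAt I 𝓘(ℝ) (fun y => mvfderiv I u y (FiberBundle.extend E w y)) x) :
    mvfderiv I (fun y => mvfderiv I u y (FiberBundle.extend E w y)) x v =
      mvfderiv I (fun y => mvfderiv I u y (FiberBundle.extend E v y)) x w := by
  have hu' : ∀ᶠ y in 𝓝 x, MDifferentiableAt I 𝓘(ℝ) u y :=
    .of_forall fun y => (hu y).mdifferentiableAt (by simp)
  rw [(mvfderiv_mvfderiv_extend I hu' v w hw).2, (mvfderiv_mvfderiv_extend I hu' w v hv).2]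
  have hc : ContDiffAt ℝ 2 (u ∘ (extChartAt I x).symm) (extChartAt I x x) := by
    have h := contMDiffAt_iff.1 (hu x)
    have h2 := h.2
    rw [I.range_eq_univ, contDiffWithinAt_univ] at h2
    exact h2.of_le (by norm_cast)
  exact fderiv_fderiv_apply_comm hc v w

theorem isLocalMax_comp_extChartAt_symm {u : M → ℝ} {x : M} (hmax : IsLocalMax u x) :
    IsLocalMax (u ∘ (extChartAt I x).symm) (extChartAt I x x) := by
  have hc := continuousAt_extChartAt_symm (I := I) x
  rw [ContinuousAt, extChartAt_to_inv] at hc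
  filter_upwards [hc.eventually hmax] with z hz
  simpa only [Function.comp_apply, extChartAt_to_inv] using hz

theorem mvfderiv_eq_zero_of_isLocalMax [I.Boundaryless] {u : M → ℝ} {x : M}
    (hmax : IsLocalMax u x) (hu : MDifferentiableAt I 𝓘(ℝ) u x) : mvfderiv I u x = 0 := by
  ext v
  have h := mvfderiv_extend I (mem_chart_source H x) hu v
  rw [FiberBundle.extend_apply_self,
    (isLocalMax_comp_extChartAt_symm I hmax).fderiv_eq_zero] at h
  exact h

/-- Second derivative test in a coordinate direction. -/
theorem mvfderiv_mvfderiv_extend_nonpos_of_isLocalMax [I.Boundaryless] {u : M → ℝ} {x : M}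
    (hmax : IsLocalMax u x) (hu : ∀ᶠ y in 𝓝 x, MDifferentiableAt I 𝓘(ℝ) u y)
    (v : TangentSpace I x)
    (hd : MDifferentiableAt I 𝓘(ℝ)
      (fun y => mvfderiv I u y (FiberBundle.extend E v y)) x) :
    mvfderiv I (fun y => mvfderiv I u y (FiberBundle.extend E v y)) x v ≤ 0 := by
  obtain ⟨hd1, hd2⟩ := mvfderiv_mvfderiv_extend I hu v v hd
  rw [hd2]
  have hc : Tendsto (extChartAt I x).symm (𝓝 (extChartAt I x x)) (𝓝 x) := by
    simpa only [ContinuousAt, extChartAt_to_inv] using continuousAt_extChartAt_symm (I := I) x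
  refine fderiv_fderiv_nonpos_of_isLocalMax (isLocalMax_comp_extChartAt_symm I hmax) ?_ hd1
  filter_upwards [hc.eventually hu, extChartAt_target_mem_nhds (I := I) x] with y hy hyt
  have hd := mdifferentiableWithinAt_extChartAt_symm (I := I) hyt
  rw [I.range_eq_univ, mdifferentiableWithinAt_univ] at hd
  exact (hy.comp y hd).differentiableAt

end Coordinates

/-! ### Gram matrices and traces -/

section Gram

variable {V ι : Type*} [NormedAddCommGroup V] [InnerProductSpace ℝ V] [Fintype ι] [DecidableEq ι]

theorem det_gram_basis_ne_zero (b : Module.Basis ι ℝ V) : (Matrix.gram ℝ b).det ≠ 0 :=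
  (Matrix.posDef_gram_of_linearIndependent b.linearIndependent).det_pos.ne'

/-- The expansion of a vector in a basis `b`, with coefficients computed from its inner products
with the vectors of `b`. -/
theorem sum_gram_inv_smul_eq (b : Module.Basis ι ℝ V) (v : V) :
    v = ∑ i, (∑ j, (Matrix.gram ℝ b)⁻¹ i j * inner ℝ v (b j)) • b i := by
  set G := Matrix.gram ℝ b with hG
  have hinv : G⁻¹ * G = 1 := Matrix.nonsing_inv_mul _ (det_gram_basis_ne_zero b).isUnit
  have hr (i : ι) : ∑ j, G⁻¹ i j * inner ℝ v (b j) = b.repr v i := by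
    calc ∑ j, G⁻¹ i j * inner ℝ v (b j) = ∑ j, ∑ k, G⁻¹ i j * (G j k * b.repr v k) := by
          refine Finset.sum_congr rfl fun j _ => ?_
          conv_lhs => rw [← b.sum_repr v, sum_inner, Finset.mul_sum]
          refine Finset.sum_congr rfl fun k _ => ?_
          rw [real_inner_smul_left, hG, Matrix.gram_apply, real_inner_comm]
          ring
      _ = ∑ k, (G⁻¹ * G) i k * b.repr v k := by
          rw [Finset.sum_comm]
          simp only [Matrix.mul_apply, Finset.sum_mul, mul_assoc]
      _ = b.repr v i := by simp [hinv, Matrix.one_apply]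
  simp only [hr, b.sum_repr]

/-- The trace of a bilinear form, computed in an orthonormal basis, in terms of an arbitrary basis. -/
theorem sum_orthonormalBasis_eq_sum_gram_inv {κ : Type*} [Fintype κ]
    (e : OrthonormalBasis κ ℝ V) (b : Module.Basis ι ℝ V) (B : V →L[ℝ] V →L[ℝ] ℝ) :
    ∑ k, B (e k) (e k) =
      ∑ i, ∑ j, (Matrix.gram ℝ b)⁻¹ i j * B (b i) (b j) := by
  set G := Matrix.gram ℝ b with hG
  calc ∑ k, B (e k) (e k)
      = ∑ k, ∑ i, ∑ j, G⁻¹ i j * inner ℝ (e k) (b j) * B (b i) (e k) := by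
        refine Finset.sum_congr rfl fun k _ => ?_
        have h := congrArg (fun v => B v (e k)) (sum_gram_inv_smul_eq b (e k))
        simpa [Finset.sum_mul, ← hG] using h
    _ = ∑ i, ∑ j, G⁻¹ i j * B (b i) (∑ k, inner ℝ (e k) (b j) • e k) := by
        rw [Finset.sum_comm]
        refine Finset.sum_congr rfl fun i _ => ?_
        rw [Finset.sum_comm]
        refine Finset.sum_congr rfl fun j _ => ?_
        simp [Finset.mul_sum, mul_assoc]
    _ = _ := by simp only [e.sum_repr']

end Gram

/-! ### Smooth families of matrices -/

section SmoothMatrix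

variable {E : Type*} [NormedAddCommGroup E] [NormedSpace ℝ E]
  {H : Type*} [TopologicalSpace H] {I : ModelWithCorners ℝ E H}
  {M : Type*} [TopologicalSpace M] [ChartedSpace H M]
  {ι : Type*} [Fintype ι] [DecidableEq ι] {k : ℕ∞ω} {A : M → Matrix ι ι ℝ} {x : M}

theorem contMDiffAt_matrix_det (hA : ∀ i j, ContMDiffAt I 𝓘(ℝ) k (fun y => A y i j) x) :
    ContMDiffAt I 𝓘(ℝ) k (fun y => (A y).det) x := by
  simp only [Matrix.det_apply']
  exact contMDiffAt_finsetSum fun σ _ =>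
    contMDiffAt_const.mul (contMDiffAt_finsetProd fun i _ => hA _ _)

theorem contMDiffAt_matrix_inv (hA : ∀ i j, ContMDiffAt I 𝓘(ℝ) k (fun y => A y i j) x)
    (hx : (A x).det ≠ 0) (i j : ι) : ContMDiffAt I 𝓘(ℝ) k (fun y => (A y)⁻¹ i j) x := by
  simp only [Matrix.inv_def, Matrix.smul_apply, smul_eq_mul, Ring.inverse_eq_inv',
    Matrix.adjugate_apply]
  refine ((contMDiffAt_matrix_det hA).inv₀ hx).mul (contMDiffAt_matrix_det fun a b => ?_)
  simp only [Matrix.updateRow_apply]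
  split_ifs
  · exact contMDiffAt_const
  · exact hA a b

end SmoothMatrix

/-! ### Smoothness of traces and gradients -/

section Smoothness

variable {E : Type*} [NormedAddCommGroup E] [NormedSpace ℝ E] [FiniteDimensional ℝ E]
  {H : Type*} [TopologicalSpace H] (I : ModelWithCorners ℝ E H)
  {M : Type*} [TopologicalSpace M] [ChartedSpace H M] [IsManifold I ∞ M]
  [RiemannianBundle (fun x : M => TangentSpace I x)]
  [IsContMDiffRiemannianBundle I ∞ E (fun x : M => TangentSpace I x)]

/-- Near every point there is a frame of the tangent bundle consisting of smooth vector fields; it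
comes from the trivialization at that point, so it need not be orthonormal. -/
theorem exists_smooth_frame (x : M) : ∃ (ι : Type) (_ : Fintype ι)
    (s : ι → Π y : M, TangentSpace I y), (∀ i, ContMDiffAt I (I.prod 𝓘(ℝ, E)) ∞ (T% (s i)) x) ∧
      ∀ᶠ y in 𝓝 x, ∃ b : Module.Basis ι ℝ (TangentSpace I y), ∀ i, b i = s i y := by
  let t := trivializationAt E (fun x : M => TangentSpace I x) x
  let b := Module.finBasis ℝ E
  have hx : x ∈ t.baseSet := FiberBundle.mem_baseSet_trivializationAt' x
  refine ⟨_, inferInstance, t.localFrame b, fun i => contMDiffAt_localFrame_of_mem _ t b i hx, ?_⟩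
  filter_upwards [t.open_baseSet.mem_nhds hx] with y hy
  exact ⟨t.basisAt b hy, fun i => (t.localFrame_apply_of_mem_baseSet b hy).symm⟩

variable {I}

theorem contMDiffAt_gram_inv {x : M} {ι : Type} [Fintype ι] [DecidableEq ι]
    {s : ι → Π y : M, TangentSpace I y}
    (hs : ∀ i, ContMDiffAt I (I.prod 𝓘(ℝ, E)) ∞ (T% (s i)) x)
    (b : Module.Basis ι ℝ (TangentSpace I x)) (hb : ∀ i, b i = s i x) (i j : ι) :
    ContMDiffAt I 𝓘(ℝ) ∞
      (fun y => (Matrix.gram ℝ fun i => s i y)⁻¹ i j) x := by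
  refine contMDiffAt_matrix_inv (A := fun y => Matrix.gram ℝ fun i => s i y)
    (fun i j => ContMDiffAt.inner_bundle (F := E) (E := fun x : M => TangentSpace I x)
      (IB := I) (b := fun y => y) (hs i) (hs j)) ?_ i j
  rw [← funext hb]
  exact det_gram_basis_ne_zero b

theorem contMDiffAt_tensor_apply {q : Π x : M, TangentSpace I x →L[ℝ] TangentSpace I x →L[ℝ] ℝ}
    (hq : IsSmoothTensor I q) {V W : Π x : M, TangentSpace I x} {x : M}
    (hV : ContMDiffAt I (I.prod 𝓘(ℝ, E)) ∞ (T% V) x)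
    (hW : ContMDiffAt I (I.prod 𝓘(ℝ, E)) ∞ (T% W) x) :
    ContMDiffAt I 𝓘(ℝ) ∞ (fun y => q y (V y) (W y)) x := by
  have : ContMDiffAt I (I.prod 𝓘(ℝ)) ∞
      (fun m => TotalSpace.mk' ℝ (E := Bundle.Trivial M ℝ) m (q m (V m) (W m))) x :=
    ContMDiffAt.clm_bundle_apply₂ (F₁ := E) (F₂ := E) (hq x) hV hW
  simp only [contMDiffAt_totalSpace] at this
  exact this.2

/-- The trace of a smooth tensor is smooth: the orthonormal bases in its definition need not depend
continuously on the point, but they can be traded for a smooth local frame and its inverse Gram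
matrix. -/
theorem contMDiff_tr {q : Π x : M, TangentSpace I x →L[ℝ] TangentSpace I x →L[ℝ] ℝ}
    (hq : IsSmoothTensor I q) : ContMDiff I 𝓘(ℝ) ∞ (tr I q) := by
  classical
  intro x
  obtain ⟨ι, _, s, hs, hb⟩ := exists_smooth_frame I x
  obtain ⟨b, hbx⟩ := hb.self_of_nhds
  have h : ContMDiffAt I 𝓘(ℝ) ∞ (fun y => ∑ i, ∑ j,
      (Matrix.gram ℝ fun i => s i y)⁻¹ i j * q y (s i y) (s j y)) x :=
    contMDiffAt_finsetSum fun i _ => contMDiffAt_finsetSum fun j _ =>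
      (contMDiffAt_gram_inv hs b hbx i j).mul (contMDiffAt_tensor_apply hq (hs i) (hs j))
  refine h.congr_of_eventuallyEq ?_
  filter_upwards [hb] with y ⟨c, hc⟩
  simp only [tr, ← hc]
  exact sum_orthonormalBasis_eq_sum_gram_inv _ c (q y)

theorem contMDiffAt_mvfderiv_apply {u : M → ℝ} (hu : ContMDiff I 𝓘(ℝ) ∞ u)
    {W : Π x : M, TangentSpace I x} {x : M} (hW : ContMDiffAt I (I.prod 𝓘(ℝ, E)) ∞ (T% W) x) :
    ContMDiffAt I 𝓘(ℝ) ∞ (fun y => mvfderiv I u y (W y)) x := by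
  have h := ((hu.contMDiff_tangentMap (m := ∞) (by simp)) _).comp x hW
  exact (contMDiff_snd_tangentBundle_modelSpace ℝ 𝓘(ℝ)).contMDiffAt.comp x h

theorem inner_grad (u : M → ℝ) (x : M) (v : TangentSpace I x) :
    inner ℝ (grad I u x) v = mvfderiv I u x v :=
  inner_sharp I _ v

theorem contMDiff_grad {u : M → ℝ} (hu : ContMDiff I 𝓘(ℝ) ∞ u) :
    ContMDiff I (I.prod 𝓘(ℝ, E)) ∞ (T% (grad I u)) := by
  classical
  intro x
  obtain ⟨ι, _, s, hs, hb⟩ := exists_smooth_frame I x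
  obtain ⟨b, hbx⟩ := hb.self_of_nhds
  have h : ContMDiffAt I (I.prod 𝓘(ℝ, E)) ∞ (T% (fun y => ∑ i, (∑ j,
      (Matrix.gram ℝ fun i => s i y)⁻¹ i j * mvfderiv I u y (s j y)) •
        s i y)) x :=
    .sum_section fun i _ => ContMDiffAt.smul_section (contMDiffAt_finsetSum fun j _ =>
      (contMDiffAt_gram_inv hs b hbx i j).mul (contMDiffAt_mvfderiv_apply hu (hs j))) (hs i)
  refine h.congr_of_eventuallyEq ?_
  filter_upwards [hb] with y ⟨c, hc⟩
  have hc' : ⇑c = fun i => s i y := funext hc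
  have := sum_gram_inv_smul_eq c (grad I u y)
  simp only [inner_grad, hc'] at this
  exact congrArg (TotalSpace.mk' E y) this

end Smoothness

/-! ### Hessian, divergence and the maximum principle for the trace -/

section Soliton

variable {E : Type*} [NormedAddCommGroup E] [NormedSpace ℝ E] [FiniteDimensional ℝ E]
  {H : Type*} [TopologicalSpace H] {I : ModelWithCorners ℝ E H} [I.Boundaryless]
  {M : Type*} [TopologicalSpace M] [ChartedSpace H M] [IsManifold I ∞ M]
  [RiemannianBundle (fun x : M => TangentSpace I x)]
  [IsContMDiffRiemannianBundle I ∞ E (fun x : M => TangentSpace I x)]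

theorem mdifferentiableAt_grad {u : M → ℝ} (hu : ContMDiff I 𝓘(ℝ) ∞ u) (x : M) :
    MDiffAt (T% (grad I u)) x :=
  (contMDiff_grad hu x).mdifferentiableAt (by simp)

theorem mdifferentiableAt_mvfderiv_extend {u : M → ℝ} (hu : ContMDiff I 𝓘(ℝ) ∞ u) (x : M)
    (v : TangentSpace I x) :
    MDifferentiableAt I 𝓘(ℝ) (fun y => mvfderiv I u y (FiberBundle.extend E v y)) x := by
  have hX : MDiffAt (T% (FiberBundle.extend E v)) x := FiberBundle.mdifferentiableAt_extend ..
  simpa only [inner_grad] using mdifferentiableAt_inner I (mdifferentiableAt_grad hu x) hX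

/-- The Hessian of a smooth function is symmetric. In the Koszul formula for coordinate vector
fields `X`, `Z`, the skew part of `g(∇_X ∇u, Z)` consists of `X(Zu) - Z(Xu)` and of `[X, Z]`, which
both vanish. -/
theorem hess_comm {u : M → ℝ} (hu : ContMDiff I 𝓘(ℝ) ∞ u) (x : M) (v w : TangentSpace I x) :
    hess I u x v w = hess I u x w v := by
  have hX (v : TangentSpace I x) : MDiffAt (T% (FiberBundle.extend E v)) x :=
    FiberBundle.mdifferentiableAt_extend ..
  have hg := mdifferentiableAt_grad hu x
  have hk (v w : TangentSpace I x) : hess I u x v w = 1 / 2 *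
      koszul I (FiberBundle.extend E v) (grad I u) (FiberBundle.extend E w) x := by
    rw [← inner_leviCivitaFun I (hX v) hg (hX w)]
    simp only [FiberBundle.extend_apply_self]
    rfl
  have hc := mvfderiv_mvfderiv_extend_comm I hu v w
    (mdifferentiableAt_mvfderiv_extend hu x v) (mdifferentiableAt_mvfderiv_extend hu x w)
  rw [hk v w, hk w v]
  simp only [koszul, mvfderiv_inner_comm I _ (grad I u), inner_grad, mlieBracket_extend,
    FiberBundle.extend_apply_self, inner_zero_left]
  rw [mlieBracket_swap_apply (V := grad I u), mlieBracket_swap_apply (V := grad I u),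
    mvfderiv_inner_comm I (FiberBundle.extend E v), hc]
  simp only [inner_neg_left]
  ring

variable {q : Π x : M, TangentSpace I x →L[ℝ] TangentSpace I x →L[ℝ] ℝ} {f : M → ℝ} {lam : ℝ}

theorem IsGradientSoliton.symm (h : IsGradientSoliton I q f lam) (x : M)
    (v w : TangentSpace I x) : q x v w = q x w v := by
  have h1 := hess_comm h.smooth_potential x v w
  rw [h.hess_eq, h.hess_eq, real_inner_comm v w] at h1
  linarith

theorem covDeriv_comm (hq : ∀ (x : M) (v w : TangentSpace I x), q x v w = q x w v) (x : M)
    (u v w : TangentSpace I x) : covDeriv I q x u v w = covDeriv I q x u w v := by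
  have e : (fun y => q y (FiberBundle.extend E v y) (FiberBundle.extend E w y)) =
      fun y => q y (FiberBundle.extend E w y) (FiberBundle.extend E v y) := by
    funext y
    exact hq y _ _
  simp only [covDeriv, covDerivAux, e]
  rw [hq x _ (FiberBundle.extend E w x), hq x (FiberBundle.extend E v x)]
  ring

theorem HamiltonIdentity.apply_grad (h : HamiltonIdentity I q f) (x : M) (w : TangentSpace I x) :
    q x (grad I f x) w = 1 / 2 * mvfderiv I (tr I q) x w := by
  rw [← inner_grad, ← real_inner_smul_left, ← h x, dualEndo, inner_sharp]

/-- At a critical point of the trace, `(∇_v q)(v, ∇f)` is half the second derivative of the trace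
in direction `v` minus `q(∇_v ∇f, v)`. -/
theorem covDeriv_grad_eq (hsol : IsGradientSoliton I q f lam) (hham : HamiltonIdentity I q f)
    {x : M} (hx : mvfderiv I (tr I q) x = 0) (v : TangentSpace I x) :
    covDeriv I q x v v (grad I f x) =
      1 / 2 * mvfderiv I (fun y => mvfderiv I (tr I q) y (FiberBundle.extend E v y)) x v
        - q x (leviCivita I (grad I f) x v) v := by
  have hX : MDiffAt (T% (FiberBundle.extend E v)) x := FiberBundle.mdifferentiableAt_extend ..
  have h := covDeriv_eq I hsol.smooth_tensor (mdifferentiableAt_grad hsol.smooth_potential x) hX v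
  rw [FiberBundle.extend_apply_self] at h
  rw [covDeriv_comm hsol.symm, h, covDerivAux]
  -- `q(∇f, ∇_v X) = ½ du(∇_v X)` vanishes, where `X` is the extension of `v` and `u = tr q`
  simp only [hham.apply_grad, hx, FiberBundle.extend_apply_self]
  have hd := mdifferentiableAt_mvfderiv_extend (contMDiff_tr hsol.smooth_tensor) x v
  rw [mvfderiv_fun_mul mdifferentiableAt_const hd, mvfderiv_const]
  simp

/-- The contraction of `q` with `Hess f` is `λ tr q + ½ |q|²`. -/
theorem IsGradientSoliton.sum_leviCivita_grad (hsol : IsGradientSoliton I q f lam) (x : M)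
    {κ : Type*} [Fintype κ] (e : OrthonormalBasis κ ℝ (TangentSpace I x)) :
    ∑ i, q x (leviCivita I (grad I f) x (e i)) (e i) =
      lam * ∑ i, q x (e i) (e i) + 1 / 2 * ∑ i, ∑ j, q x (e i) (e j) ^ 2 := by
  classical
  rw [Finset.mul_sum, Finset.mul_sum, ← Finset.sum_add_distrib]
  refine Finset.sum_congr rfl fun i _ => ?_
  have h : leviCivita I (grad I f) x (e i) =
      ∑ j, (lam * inner ℝ (e i) (e j) + 1 / 2 * q x (e i) (e j)) • e j := by
    rw [← e.sum_repr' (leviCivita I (grad I f) x (e i))]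
    refine Finset.sum_congr rfl fun j _ => ?_
    rw [real_inner_comm, ← hsol.hess_eq]
    rfl
  rw [h, map_sum, sum_apply]
  simp only [map_smul, FunLike.coe_smul, Pi.smul_apply, smul_eq_mul, add_mul,
    Finset.sum_add_distrib, e.inner_eq_ite, mul_ite, ite_mul]
  simp [Finset.mul_sum]
  refine Finset.sum_congr rfl fun j _ => ?_
  rw [hsol.symm x (e j) (e i)]
  ring

/-- The maximum principle: `tr q` is nonpositive at each of its local maxima. -/
theorem tr_nonpos_of_isLocalMax (hsol : IsGradientSoliton I q f lam)
    (hham : HamiltonIdentity I q f) (hlam : 0 ≤ lam)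
    {x : M} (hdiv : 0 ≤ div I q x (grad I f x)) (hmax : IsLocalMax (tr I q) x) :
    tr I q x ≤ 0 := by
  have htr := contMDiff_tr hsol.smooth_tensor
  have hd : ∀ᶠ y in 𝓝 x, MDifferentiableAt I 𝓘(ℝ) (tr I q) y :=
    .of_forall fun y => (htr y).mdifferentiableAt (by simp)
  have hcrit : mvfderiv I (tr I q) x = 0 :=
    mvfderiv_eq_zero_of_isLocalMax I hmax hd.self_of_nhds
  by_contra! hpos
  set e := stdOrthonormalBasis ℝ (TangentSpace I x)
  have h1 (i) : covDeriv I q x (e i) (e i) (grad I f x) ≤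
      - q x (leviCivita I (grad I f) x (e i)) (e i) := by
    rw [covDeriv_grad_eq hsol hham hcrit]
    linarith [mvfderiv_mvfderiv_extend_nonpos_of_isLocalMax I hmax hd (e i)
      (mdifferentiableAt_mvfderiv_extend htr x (e i))]
  have h2 : 0 ≤ ∑ i, - q x (leviCivita I (grad I f) x (e i)) (e i) :=
    hdiv.trans (Finset.sum_le_sum fun i _ => h1 i)
  rw [Finset.sum_neg_distrib, hsol.sum_leviCivita_grad x e] at h2
  have h3 : 0 ≤ lam * ∑ i, q x (e i) (e i) := mul_nonneg hlam hpos.le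
  have h4 (i) : q x (e i) (e i) = 0 := by
    have h5 : ∀ j ∈ Finset.univ, 0 ≤ ∑ k, q x (e j) (e k) ^ 2 := fun j _ =>
      Finset.sum_nonneg fun k _ => sq_nonneg _
    have h6 := Finset.single_le_sum h5 (Finset.mem_univ i)
    have h7 := Finset.single_le_sum (fun k _ => sq_nonneg (q x (e i) (e k))) (Finset.mem_univ i)
    exact pow_eq_zero_iff two_ne_zero |>.1 (le_antisymm (by linarith) (sq_nonneg _))
  exact hpos.ne' (Finset.sum_eq_zero fun i _ => h4 i)

end Soliton

/-- A continuous function with a positive value that is asymptotically nonpositive at infinity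
attains its maximum. -/
theorem exists_isMax_of_liminf {X : Type*} [TopologicalSpace X] {u : X → ℝ} (hu : Continuous u)
    (hlim : 0 ≤ liminf (fun x : X => ((-(1 / 2) * u x : ℝ) : EReal)) (cocompact X))
    {x₀ : X} (hx₀ : 0 < u x₀) : ∃ x, ∀ y, u y ≤ u x := by
  have hev : ∀ᶠ x in cocompact X, u x ≤ u x₀ := by
    have h : ((-(1 / 2) * u x₀ : ℝ) : EReal) <
        liminf (fun x : X => ((-(1 / 2) * u x : ℝ) : EReal)) (cocompact X) :=
      lt_of_lt_of_le (by exact_mod_cast (by linarith : -(1 / 2) * u x₀ < 0)) hlim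
    filter_upwards [eventually_lt_of_lt_liminf h] with x hx
    have := EReal.coe_lt_coe_iff.1 hx
    linarith
  exact hu.exists_forall_ge' x₀ hev

end QSoliton

theorem proposition3p4 (n : ℕ) (M : Type*) [EMetricSpace M]
    [ChartedSpace (EuclideanSpace ℝ (Fin n)) M] [IsManifold (𝓡 n) ∞ M]
    [RiemannianBundle (fun x : M => TangentSpace (𝓡 n) x)]
    [IsContMDiffRiemannianBundle (𝓡 n) ∞ (EuclideanSpace ℝ (Fin n))
      (fun x : M => TangentSpace (𝓡 n) x)]
    [IsRiemannianManifold (𝓡 n) M] [CompleteSpace M] [NoncompactSpace M]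
    (q : Π x : M, TangentSpace (𝓡 n) x →L[ℝ] TangentSpace (𝓡 n) x →L[ℝ] ℝ)
    (f : M → ℝ) (lam : ℝ)
    (hsol : QSoliton.IsGradientSoliton (𝓡 n) q f lam)
    (hham : QSoliton.HamiltonIdentity (𝓡 n) q f)
    (hlam : 0 ≤ lam)
    (hlim : 0 ≤ liminf (fun x : M => ((-(1 / 2) * QSoliton.tr (𝓡 n) q x : ℝ) : EReal))
      (cocompact M))
    (hdiv : ∀ x : M, 0 ≤ QSoliton.div (𝓡 n) q x (QSoliton.grad (𝓡 n) f x)) :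
    ∀ x : M, QSoliton.tr (𝓡 n) q x ≤ 0 := by
  intro x₀
  by_contra! hx₀
  obtain ⟨x, hx⟩ := QSoliton.exists_isMax_of_liminf
    (QSoliton.contMDiff_tr hsol.smooth_tensor).continuous hlim hx₀
  have h := QSoliton.tr_nonpos_of_isLocalMax hsol hham hlam (hdiv x)
    (Filter.Eventually.of_forall hx)
  exact absurd (hx x₀) (by linarith)
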